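/- Let $(W,\Sigma)$ be a Coxeter system ($\Sigma$ possibly infinite), with Coxeter matrix $(m_{s,t})_{s,t\in\Sigma}$ and word length $\ell$ with respect to $\Sigma$. Let $\mathrm{Der}(W,\Sigma)$ be the set $W$ equipped with the distinguished element $1$ and the partial product $\bullet$ such that $f\bullet g$ is defined if and only if $\ell(fg)=\ell(f)+\ell(g)$, in which case $f\bullet g=fg$. This is a germ: $1\bullet f=f=f\bullet 1$ for all $f$, and, if $f\bullet g$ and $g\bullet h$ are defined, then $(f\bullet g)\bullet h$ is defined if and only if $f\bullet(g\bullet h)$ is, in which case they are equal. Then: (1) $\mathrm{Der}(W,\Sigma)$ is a Garside germ, that is, there exist a left-cancellative monoid $C$ and an injection $\iota:W\to C$ with $\iota(1)=1$ such that, for all $f,g,h\in W$, one has $f\bullet g=h$ (with $f\bullet g$ defined) if and only if $\iota(f)\iota(g)=\iota(h)$, and such that $S=\iota(W)$ is a full Garside family in $C$. Here $S$ is *full* if $1\in S$ and every right-divisor in $C$ of an element of $S$ lies in $S$; and $S$ is a *Garside family* if every element of $C$ can be written as a product $g_1\cdots g_q$ with $q\ge 0$ and all $g_i\in SC^\times\cup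 C^\times$ (where $C^\times$ is the set of invertible elements of $C$) such that, for all $1\le i<q$, $h\in S$ and $f\in C$, if $h$ left-divides $fg_ig_{i+1}$ then $h$ left-divides $fg_i$. (2) The monoid generated by $\mathrm{Der}(W,\Sigma)$, that is, the monoid presented by the generators $[w]$, $w\in W$, and the relations $[1]=1$ and $[f][g]=[fg]$ for all $f,g\in W$ with $\ell(fg)=\ell(f)+\ell(g)$, is the Artin–Tits (braid) monoid of $(W,\Sigma)$: there is an isomorphism, mapping $[s]$ to $\sigma_s$ for every $s\in\Sigma$, from this monoid onto the monoid presented by the generators $\sigma_s$, $s\in\Sigma$, and the relations $$\underbrace{\sigma_s\sigma_t\sigma_s\cdots}_{m_{s,t}}=\underbrace{\sigma_t\sigma_s\sigma_t\cdots}_{m_{s,t}}\qquad(s\neq t,\ m_{s,t}<\infty).$$ -/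

import Mathlib

/-! ### Garside families in a left-cancellative monoid

In a monoid, `a ∣ b` means `∃ c, b = a * c`, i.e. `a` is a left-divisor of `b`. -/

section GarsideFamily

variable {C : Type*} [Monoid C]

/-- `S♯ = S Cˣ ∪ Cˣ`, where `Cˣ` is the family of invertible elements. -/
def sharpFamily (S : Set C) : Set C :=
  {g | (∃ s ∈ S, ∃ e, IsUnit e ∧ g = s * e) ∨ IsUnit g}

/-- A path `g₁ | ⋯ | g_q` is `S`-greedy if, for all consecutive entries `g_i`, `g_{i+1}`,
every `h ∈ S` that left-divides `f g_i g_{i+1}` left-divides `f g_i`, for every `f`. -/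
def IsGreedyPath (S : Set C) (l : List C) : Prop :=
  l.IsChain fun g₁ g₂ => ∀ h ∈ S, ∀ f : C, h ∣ f * g₁ * g₂ → h ∣ f * g₁

/-- A path is `S`-normal if it is `S`-greedy with entries in `S♯`. -/
def IsNormalPath (S : Set C) (l : List C) : Prop :=
  IsGreedyPath S l ∧ ∀ g ∈ l, g ∈ sharpFamily S

/-- `S` is a Garside family: every element has an `S`-normal decomposition. (To be used in a
left-cancellative monoid.) -/
def IsGarsideFamily (S : Set C) : Prop :=
  ∀ g : C, ∃ l : List C, IsNormalPath S l ∧ l.prod = g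

/-- `S` is full: it contains the identity and is closed under right-divisor. -/
def IsFullFamily (S : Set C) : Prop :=
  (1 : C) ∈ S ∧ ∀ f g : C, f * g ∈ S → g ∈ S

end GarsideFamily

/-! ### Germs (with one object) -/

/-- A germ with one object: a set `S` with a distinguished element and a partial product
(`mul f g = none` means that the product of `f` and `g` is not defined). The last law says that,
if the products `fg` and `gh` are defined, then `(fg)h` is defined if and only if `f(gh)` is, in
which case they are equal. -/
structure Germ (S : Type*) where
  one : S
  mul : S → S → Option S
  one_mul : ∀ f, mul one f = some f
  mul_one : ∀ f, mul f one = some f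
  assoc : ∀ f g h fg gh, mul f g = some fg → mul g h = some gh → mul fg h = mul f gh

namespace Germ

universe u

variable {S : Type u} (G : Germ S)

/-- The defining relations of the monoid of a germ: the distinguished element is the identity,
and `f | g = f • g` whenever the product `f • g` is defined. -/
inductive Rel : FreeMonoid S → FreeMonoid S → Prop
  | one : Rel (FreeMonoid.of G.one) 1
  | mul (f g h : S) : G.mul f g = some h →
      Rel (FreeMonoid.of f * FreeMonoid.of g) (FreeMonoid.of h)

/-- The monoid generated by a germ. -/
abbrev Mon : Type u := PresentedMonoid G.Rel

/-- `G` is a Garside germ: there is a left-cancellative monoid `C` in which `S` embeds as a full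
Garside family in such a way that the partial product of `G` is the one induced by the product
of `C`. (A category with a full subfamily that has only one object is a monoid.) -/
def IsGarside : Prop :=
  ∃ (C : Type u) (_ : Monoid C) (ι : S → C),
    IsLeftCancelMul C ∧
    Function.Injective ι ∧
    ι G.one = 1 ∧
    (∀ f g h : S, G.mul f g = some h ↔ ι f * ι g = ι h) ∧
    IsFullFamily (Set.range ι) ∧
    IsGarsideFamily (Set.range ι)

end Germ

/-! ### The germ and the monoid of a Coxeter system -/

/-- The germ derived from the whole group `W` of a Coxeter system and its simple reflections:
the product of `f` and `g` is `f * g` if `ℓ (f * g) = ℓ f + ℓ g`, and is undefined otherwise. -/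
noncomputable def CoxeterSystem.derivedGerm {B W : Type*} [Group W] {M : CoxeterMatrix B}
    (cs : CoxeterSystem M W) : Germ W where
  one := 1
  mul f g := if cs.length (f * g) = cs.length f + cs.length g then some (f * g) else none
  one_mul f := by simp
  mul_one f := by simp
  assoc f g h fg gh h₁ h₂ := by
    simp only [Option.ite_none_right_eq_some, Option.some.injEq] at h₁ h₂
    obtain ⟨h₁, rfl⟩ := h₁
    obtain ⟨h₂, rfl⟩ := h₂
    simp only [mul_assoc, h₁, h₂, add_assoc]

/-- The Artin–Tits relations: for `i ≠ j` with `M i j` finite (infinity is encoded by `0`), the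
two alternating words of length `M i j` in the letters `i`, `j` are equal. -/
inductive CoxeterMatrix.ArtinRel {B : Type*} (M : CoxeterMatrix B) :
    FreeMonoid B → FreeMonoid B → Prop
  | braid (i j : B) : i ≠ j → M i j ≠ 0 →
      CoxeterMatrix.ArtinRel M (FreeMonoid.ofList (CoxeterSystem.braidWord M i j))
        (FreeMonoid.ofList (CoxeterSystem.braidWord M j i))

/-- The Artin–Tits (braid) monoid of a Coxeter matrix. -/
abbrev CoxeterMatrix.ArtinMonoid {B : Type*} (M : CoxeterMatrix B) : Type _ :=
  PresentedMonoid M.ArtinRel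

/-!
A germ embeds into the monoid it generates as soon as every word `f | v` of length two has a greedy
split `c | b`, where `c = f • a`, `v = a • b` and `a` is the greatest prefix of `v` that `f` can
absorb. The domino rule (splitting first for `g` and then for `f` is splitting for `f • g`) says
that absorption is an action of the monoid on pairs (head, tail). This action computes the greatest
element of the germ that left-divides a given element of the monoid, which yields left cancellation,
the injectivity of the embedding and greedy normal forms.

In a Coxeter group, the prefixes `h` of `v` for which the product of `f` and `h` is reduced have a
greatest element by Newman's lemma. Local confluence takes place in a parabolic subgroup of rank
two: two simple reflections that prolong `h` in this set are left descents of the rest of `v`, hence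
of its component in the parabolic subgroup they generate, and `h` can be prolonged by this whole
component.

The isomorphism with the Artin–Tits monoid is Matsumoto's theorem. It needs that alternating words
of length at most `M i j` are reduced, thus that `M i j` is the exact order of the product of two
simple reflections, which is seen in the geometric representation.
-/

/-! ### Greedy normal forms in germs -/

namespace Germ

section GreedySplits

variable {S : Type*} {G : Germ S}

theorem mul_mul_eq_mul_mul {f g h fg gh k : S} (hfg : G.mul f g = some fg)
    (hgh : G.mul g h = some gh) : G.mul fg h = some k ↔ G.mul f gh = some k := by
  rw [G.assoc f g h fg gh hfg hgh]

/-- Left-divisibility inside the germ itself: `h = f • g` for some `g`. -/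
def IsPrefix (G : Germ S) (f h : S) : Prop :=
  ∃ g, G.mul f g = some h

/-- The greedy rewriting of the word `f | v` as `c | b`: the entry `c = f • a` absorbs the greatest
prefix `a` of `v` that can be multiplied by `f` on the left, and `v = a • b`. -/
structure IsGreedySplit (G : Germ S) (f v a b c : S) : Prop where
  mul_absorbed : G.mul f a = some c
  mul_rest : G.mul a b = some v
  isPrefix_absorbed : ∀ h k, G.IsPrefix h v → G.mul f h = some k → G.IsPrefix h a

/-- The germs in which words can be normalized greedily: they are left-associative and
left-cancellative, without nontrivial invertible elements, and every word of length two has a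
greedy split. -/
structure HasGreedySplits (G : Germ S) : Prop where
  exists_mul_eq : ∀ f g h fg k, G.mul f g = some fg → G.mul fg h = some k →
    ∃ gh, G.mul g h = some gh
  mul_left_cancel : ∀ f g h k, G.mul f g = some k → G.mul f h = some k → g = h
  eq_one_of_mul_eq_one : ∀ f g, G.mul f g = some G.one → g = G.one
  exists_isGreedySplit : ∀ f v, ∃ a b c, G.IsGreedySplit f v a b c

theorem isGreedySplit_one_left (v : S) : G.IsGreedySplit G.one v v G.one v where
  mul_absorbed := G.one_mul v
  mul_rest := G.mul_one v
  isPrefix_absorbed _ _ h _ := h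

theorem isGreedySplit_one_right (f : S) : G.IsGreedySplit f G.one G.one G.one f where
  mul_absorbed := G.mul_one f
  mul_rest := G.mul_one G.one
  isPrefix_absorbed _ _ h _ := h

namespace HasGreedySplits

variable (hG : G.HasGreedySplits) {f g h k v a b c : S}

include hG

theorem exists_mul_eq_and_mul_eq {fg : S} (hfg : G.mul f g = some fg) (hk : G.mul fg h = some k) :
    ∃ gh, G.mul g h = some gh ∧ G.mul f gh = some k := by
  obtain ⟨gh, hgh⟩ := hG.exists_mul_eq f g h fg k hfg hk
  exact ⟨gh, hgh, (mul_mul_eq_mul_mul hfg hgh).mp hk⟩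

theorem isPrefix_antisymm (hfg : G.IsPrefix f g) (hgf : G.IsPrefix g f) : f = g := by
  obtain ⟨x, hx⟩ := hfg
  obtain ⟨y, hy⟩ := hgf
  obtain ⟨xy, hxy, hf⟩ := hG.exists_mul_eq_and_mul_eq hx hy
  obtain rfl := hG.mul_left_cancel f _ _ f hf (G.mul_one f)
  obtain rfl := hG.eq_one_of_mul_eq_one x y hxy
  exact (Option.some.inj (hy.symm.trans (G.mul_one g)))

theorem isPrefix_of_mul_isPrefix_mul {fg fh : S} (hg : G.mul f g = some fg)
    (hh : G.mul f h = some fh) (hp : G.IsPrefix fg fh) : G.IsPrefix g h := by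
  obtain ⟨x, hx⟩ := hp
  obtain ⟨gx, hgx, hfgx⟩ := hG.exists_mul_eq_and_mul_eq hg hx
  exact ⟨x, hG.mul_left_cancel f _ _ fh hfgx hh ▸ hgx⟩

theorem isGreedySplit_unique {a' b' c' : S} (hs : G.IsGreedySplit f v a b c)
    (hs' : G.IsGreedySplit f v a' b' c') : a = a' ∧ b = b' ∧ c = c' := by
  obtain rfl : a = a' := hG.isPrefix_antisymm
    (hs'.isPrefix_absorbed a c ⟨b, hs.mul_rest⟩ hs.mul_absorbed)
    (hs.isPrefix_absorbed a' c' ⟨b', hs'.mul_rest⟩ hs'.mul_absorbed)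
  exact ⟨rfl, hG.mul_left_cancel a _ _ v hs.mul_rest hs'.mul_rest,
    Option.some.inj (hs.mul_absorbed.symm.trans hs'.mul_absorbed)⟩

/-- The domino rule of Garside theory. -/
theorem isGreedySplit_mul {a' b' c' : S} (hfg : G.mul f g = some k)
    (hs : G.IsGreedySplit g v a b c) (hs' : G.IsGreedySplit f c a' b' c') :
    ∃ e d, G.IsGreedySplit k v e d c' ∧ G.mul b' b = some d := by
  obtain ⟨e, he⟩ : G.IsPrefix g a' := hs'.isPrefix_absorbed g k ⟨a, hs.mul_absorbed⟩ hfg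
  have ha : G.mul e b' = some a := by
    obtain ⟨x, hx, hgx⟩ := hG.exists_mul_eq_and_mul_eq he hs'.mul_rest
    rwa [hG.mul_left_cancel g _ _ c hgx hs.mul_absorbed] at hx
  obtain ⟨d, hd, hed⟩ := hG.exists_mul_eq_and_mul_eq ha hs.mul_rest
  refine ⟨e, d, ⟨(mul_mul_eq_mul_mul hfg he).mpr hs'.mul_absorbed, hed, ?_⟩, hd⟩
  intro h l hhv hkh
  obtain ⟨gh, hgh, hfgh⟩ := hG.exists_mul_eq_and_mul_eq hfg hkh
  obtain ⟨y, hy⟩ := hs.isPrefix_absorbed h gh hhv hgh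
  have hghc : G.IsPrefix gh c := ⟨y, (mul_mul_eq_mul_mul hgh hy).mpr hs.mul_absorbed⟩
  exact hG.isPrefix_of_mul_isPrefix_mul hgh he (hs'.isPrefix_absorbed gh l hghc hfgh)

end HasGreedySplits

end GreedySplits

section Mon

variable {S : Type*} (G : Germ S)

/-- The canonical map from a germ to the monoid it generates. -/
def toMon : S → G.Mon :=
  PresentedMonoid.of G.Rel

theorem toMon_one : G.toMon G.one = 1 :=
  PresentedMonoid.mk_eq_mk_of_rel Rel.one

variable {G} in
theorem toMon_mul_toMon {f g h : S} (hfg : G.mul f g = some h) :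
    G.toMon f * G.toMon g = G.toMon h :=
  PresentedMonoid.mk_eq_mk_of_rel (Rel.mul f g h hfg)

theorem exists_prod_map_toMon_eq (x : G.Mon) : ∃ l : List S, (l.map G.toMon).prod = x := by
  induction x using PresentedMonoid.inductionOn with
  | _ l =>
    refine ⟨l.toList, ?_⟩
    change _ = PresentedMonoid.mk G.Rel l
    induction l using FreeMonoid.inductionOn' with
    | one => simp
    | of_mul f l ih => simp [← ih, toMon, PresentedMonoid.of]

variable {G} in
@[elab_as_elim]
theorem mon_induction {p : G.Mon → Prop} (one : p 1)
    (mul : ∀ f x, p x → p (G.toMon f * x)) (x : G.Mon) : p x := by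
  obtain ⟨l, rfl⟩ := G.exists_prod_map_toMon_eq x
  induction l with
  | nil => exact one
  | cons f l ih => exact mul f _ ih

variable {N : Type*} [Monoid N]

/-- The universal property of the monoid of a germ. -/
def lift (φ : S → N) (map_one : φ G.one = 1)
    (map_mul : ∀ f g h, G.mul f g = some h → φ f * φ g = φ h) : G.Mon →* N :=
  PresentedMonoid.lift φ fun _ _ hr => by
    cases hr with
    | one => simpa using map_one
    | mul f g h hfg => simpa using map_mul f g h hfg

end Mon

namespace HasGreedySplits

variable {S : Type*} {G : Germ S} (hG : G.HasGreedySplits)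

/-- Left multiplication by a letter `f` on pairs `(v, z)`, which stand for the products `v * z`
with a greedily chosen first factor. -/
noncomputable def prepend (f : S) : Function.End (S × G.Mon) := fun p =>
  ((hG.exists_isGreedySplit f p.1).choose_spec.choose_spec.choose,
    G.toMon (hG.exists_isGreedySplit f p.1).choose_spec.choose * p.2)

variable {f g k v a b c : S}

include hG

theorem prepend_apply (hs : G.IsGreedySplit f v a b c) (z : G.Mon) :
    hG.prepend f (v, z) = (c, G.toMon b * z) := by
  obtain ⟨-, hb, hc⟩ := hG.isGreedySplit_unique
    (hG.exists_isGreedySplit f v).choose_spec.choose_spec.choose_spec hs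
  exact Prod.ext hc (congrArg (G.toMon · * z) hb)

theorem prepend_one : hG.prepend G.one = 1 := by
  funext ⟨v, z⟩
  rw [hG.prepend_apply (isGreedySplit_one_left v), toMon_one, _root_.one_mul]
  rfl

theorem prepend_mul_prepend (hfg : G.mul f g = some k) :
    hG.prepend f * hG.prepend g = hG.prepend k := by
  funext ⟨v, z⟩
  obtain ⟨a, b, c, hs⟩ := hG.exists_isGreedySplit g v
  obtain ⟨a', b', c', hs'⟩ := hG.exists_isGreedySplit f c
  obtain ⟨e, d, hk, hd⟩ := hG.isGreedySplit_mul hfg hs hs'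
  change hG.prepend f (hG.prepend g (v, z)) = _
  rw [hG.prepend_apply hs, hG.prepend_apply hs',
    hG.prepend_apply hk, ← mul_assoc, toMon_mul_toMon hd]

/-- The action of the monoid of a germ on pairs `(v, z)` by greedy left multiplication. -/
noncomputable def prependHom : G.Mon →* Function.End (S × G.Mon) :=
  G.lift hG.prepend hG.prepend_one fun _ _ _ => hG.prepend_mul_prepend

theorem prependHom_toMon_mul (f : S) (x : G.Mon) (p : S × G.Mon) :
    hG.prependHom (G.toMon f * x) p = hG.prepend f (hG.prependHom x p) := by
  rw [map_mul]
  rfl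

theorem toMon_prependHom_fst_mul_snd (x : G.Mon) (v : S) (z : G.Mon) :
    G.toMon (hG.prependHom x (v, z)).1 * (hG.prependHom x (v, z)).2 = x * (G.toMon v * z) := by
  induction x using mon_induction with
  | one => simp [Function.End.one_def]
  | mul f x ih =>
    rw [hG.prependHom_toMon_mul, mul_assoc, ← ih]
    obtain ⟨v', z'⟩ := hG.prependHom x (v, z)
    obtain ⟨a, b, c, hs⟩ := hG.exists_isGreedySplit f v'
    rw [hG.prepend_apply hs, ← toMon_mul_toMon hs.mul_absorbed, ← toMon_mul_toMon hs.mul_rest]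
    simp only [mul_assoc]

theorem prependHom_fst_eq (x : G.Mon) (v : S) (y z : G.Mon) :
    (hG.prependHom x (v, y)).1 = (hG.prependHom x (v, z)).1 := by
  induction x using mon_induction with
  | one => simp [Function.End.one_def]
  | mul f x ih => simp only [hG.prependHom_toMon_mul, prepend, ih]

/-- The greatest element of the germ that left-divides `x`. -/
noncomputable def head (x : G.Mon) : S := (hG.prependHom x (G.one, 1)).1

/-- The quotient of `x` by its head. -/
noncomputable def tail (x : G.Mon) : G.Mon := (hG.prependHom x (G.one, 1)).2

theorem toMon_head_mul_tail (x : G.Mon) : G.toMon (hG.head x) * hG.tail x = x := by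
  rw [head, tail, hG.toMon_prependHom_fst_mul_snd, toMon_one, _root_.mul_one, _root_.mul_one]

theorem head_tail_toMon_mul {x : G.Mon} (hs : G.IsGreedySplit f (hG.head x) a b c) :
    hG.head (G.toMon f * x) = c ∧ hG.tail (G.toMon f * x) = G.toMon b * hG.tail x := by
  have h : hG.prependHom (G.toMon f * x) (G.one, 1) = (c, G.toMon b * hG.tail x) := by
    rw [hG.prependHom_toMon_mul, ← hG.prepend_apply hs]
    rfl
  exact ⟨congrArg Prod.fst h, congrArg Prod.snd h⟩

theorem head_tail_one : hG.head 1 = G.one ∧ hG.tail 1 = 1 := by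
  simp [head, tail, Function.End.one_def]

theorem head_tail_toMon (f : S) : hG.head (G.toMon f) = f ∧ hG.tail (G.toMon f) = 1 := by
  have hs : G.IsGreedySplit f (hG.head 1) G.one G.one f :=
    (hG.head_tail_one).1.symm ▸ isGreedySplit_one_right f
  simpa [hG.head_tail_one, toMon_one] using hG.head_tail_toMon_mul hs

theorem toMon_injective : Function.Injective G.toMon :=
  Function.LeftInverse.injective (g := hG.head) fun f => (hG.head_tail_toMon f).1

theorem head_mul (x y : G.Mon) : hG.head (x * y) = hG.head (x * G.toMon (hG.head y)) := by
  have h (y : G.Mon) : hG.head (x * y) = (hG.prependHom x (hG.head y, hG.tail y)).1 := by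
    rw [head, map_mul]
    rfl
  rw [h, h, (hG.head_tail_toMon _).1]
  exact hG.prependHom_fst_eq x _ _ _

theorem toMon_dvd_iff {x : G.Mon} : G.toMon f ∣ x ↔ G.IsPrefix f (hG.head x) := by
  constructor
  · rintro ⟨y, rfl⟩
    obtain ⟨a, b, c, hs⟩ := hG.exists_isGreedySplit f (hG.head y)
    rw [(hG.head_tail_toMon_mul hs).1]
    exact ⟨a, hs.mul_absorbed⟩
  · rintro ⟨g, hg⟩
    refine ⟨G.toMon g * hG.tail x, ?_⟩
    rw [← mul_assoc, toMon_mul_toMon hg, hG.toMon_head_mul_tail]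

theorem toMon_mul_left_cancel {x y : G.Mon}
    (h : G.toMon f * x = G.toMon f * y) : x = y := by
  obtain ⟨a, b, c, hx⟩ := hG.exists_isGreedySplit f (hG.head x)
  obtain ⟨a', b', c', hy⟩ := hG.exists_isGreedySplit f (hG.head y)
  obtain ⟨hcx, hbx⟩ := hG.head_tail_toMon_mul hx
  obtain ⟨hcy, hby⟩ := hG.head_tail_toMon_mul hy
  obtain rfl : c = c' := by rw [← hcx, h, hcy]
  obtain rfl : a = a' := hG.mul_left_cancel f _ _ c hx.mul_absorbed hy.mul_absorbed
  rw [← hG.toMon_head_mul_tail x, ← hG.toMon_head_mul_tail y,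
    ← toMon_mul_toMon hx.mul_rest, ← toMon_mul_toMon hy.mul_rest, mul_assoc, mul_assoc, ← hbx,
    ← hby, h]

theorem isLeftCancelMul_mon : IsLeftCancelMul G.Mon where
  mul_left_cancel x := by
    induction x using mon_induction with
    | one => simp [IsLeftRegular, Function.Injective]
    | mul f x ih =>
      intro y z h
      exact ih (hG.toMon_mul_left_cancel (f := f) (by simpa only [mul_assoc] using h))

theorem toMon_mul_toMon_eq_iff {f g h : S} :
    G.toMon f * G.toMon g = G.toMon h ↔ G.mul f g = some h := by
  refine ⟨fun hfg => ?_, toMon_mul_toMon⟩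
  obtain ⟨a, b, c, hs⟩ := hG.exists_isGreedySplit f g
  obtain ⟨hc, hb⟩ := hG.head_tail_toMon_mul ((hG.head_tail_toMon g).1.symm ▸ hs)
  rw [hfg, (hG.head_tail_toMon _).1] at hc
  rw [hfg, (hG.head_tail_toMon _).2, (hG.head_tail_toMon _).2, _root_.mul_one, ← toMon_one] at hb
  obtain rfl := hG.toMon_injective hb
  obtain rfl : a = g := Option.some.inj ((G.mul_one a).symm.trans hs.mul_rest)
  rw [hs.mul_absorbed, hc]

theorem isFullFamily_range_toMon :
    IsFullFamily (Set.range G.toMon) := by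
  refine ⟨⟨G.one, G.toMon_one⟩, fun x => ?_⟩
  induction x using mon_induction with
  | one => simp
  | mul f x ih =>
    rintro y ⟨w, hw⟩
    rw [mul_assoc] at hw
    obtain ⟨g, hg⟩ : G.IsPrefix f w := by
      rw [← (hG.head_tail_toMon w).1, ← hG.toMon_dvd_iff]
      exact ⟨_, hw⟩
    exact ih y ⟨g, hG.toMon_mul_left_cancel ((toMon_mul_toMon hg).trans hw)⟩

theorem head_toMon_head_mul {x y z : G.Mon} (h : hG.tail x = y * z) :
    hG.head (G.toMon (hG.head x) * y) = hG.head x := by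
  apply hG.isPrefix_antisymm
  · rw [← hG.toMon_dvd_iff]
    refine (hG.toMon_dvd_iff.mpr ⟨_, G.mul_one _⟩ : G.toMon _ ∣ _).trans ⟨z, ?_⟩
    rw [mul_assoc, ← h, hG.toMon_head_mul_tail]
  · exact hG.toMon_dvd_iff.mp ⟨y, rfl⟩

theorem exists_tail_eq_prod_map_toMon (f : S) (l : List S) :
    ∃ l' : List S, l'.length = l.length ∧
      hG.tail ((f :: l).map G.toMon).prod = (l'.map G.toMon).prod := by
  induction l generalizing f with
  | nil => exact ⟨[], rfl, by simp [hG.head_tail_toMon]⟩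
  | cons g l ih =>
    obtain ⟨l', hlen, hl'⟩ := ih g
    obtain ⟨a, b, c, hs⟩ := hG.exists_isGreedySplit f (hG.head ((g :: l).map G.toMon).prod)
    refine ⟨b :: l', by simp [hlen], ?_⟩
    rw [List.map_cons, List.prod_cons, (hG.head_tail_toMon_mul hs).2, hl', List.map_cons,
      List.prod_cons]

theorem isNormalPath_cons_head {x : G.Mon} {l : List G.Mon}
    (hl : IsNormalPath (Set.range G.toMon) l) (hx : l.prod = hG.tail x) :
    IsNormalPath (Set.range G.toMon) (G.toMon (hG.head x) :: l) := by
  have hmem : G.toMon (hG.head x) ∈ sharpFamily (Set.range G.toMon) :=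
    Or.inl ⟨_, ⟨_, rfl⟩, 1, isUnit_one, (_root_.mul_one _).symm⟩
  refine ⟨?_, List.forall_mem_cons.mpr ⟨hmem, hl.2⟩⟩
  cases l with
  | nil => exact List.isChain_singleton _
  | cons y l =>
    refine List.isChain_cons_cons.mpr ⟨?_, hl.1⟩
    rintro _ ⟨w, rfl⟩ f hdvd
    rw [List.prod_cons] at hx
    rw [hG.toMon_dvd_iff] at hdvd ⊢
    rwa [mul_assoc, hG.head_mul, hG.head_toMon_head_mul hx.symm] at hdvd

theorem isGarsideFamily_range_toMon :
    IsGarsideFamily (Set.range G.toMon) := by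
  intro x
  obtain ⟨l, rfl⟩ := G.exists_prod_map_toMon_eq x
  induction hn : l.length generalizing l with
  | zero =>
    rw [List.length_eq_zero_iff] at hn
    exact ⟨[], ⟨List.isChain_nil, by simp⟩, by simp [hn]⟩
  | succ n ih =>
    obtain ⟨f, l, rfl⟩ := List.exists_cons_of_length_eq_add_one hn
    obtain ⟨l', hlen, htail⟩ := hG.exists_tail_eq_prod_map_toMon f l
    obtain ⟨p, hp, hprod⟩ := ih l' (by simpa [hlen] using hn)
    exact ⟨_, hG.isNormalPath_cons_head hp (hprod.trans htail.symm), by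
      rw [List.prod_cons, hprod, ← htail, hG.toMon_head_mul_tail]⟩

theorem isGarside : G.IsGarside :=
  ⟨G.Mon, inferInstance, G.toMon, hG.isLeftCancelMul_mon, hG.toMon_injective, G.toMon_one,
    fun _ _ _ => hG.toMon_mul_toMon_eq_iff.symm, hG.isFullFamily_range_toMon,
    hG.isGarsideFamily_range_toMon⟩

end HasGreedySplits

end Germ

namespace CoxeterGerm

/-! ### The geometric representation -/

section Reflections

open Module Real

variable {R V : Type*} [CommRing R] [AddCommGroup V] [Module R V] {x y : V} {f g : Dual R V}

theorem reflection_mul_reflection_apply_of_recurrence (hf : f x = 2) (hg : g y = 2) {t : R}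
    (hfy : f y = -t) (hgx : g x = -t) {a : ℕ → R} (ha : ∀ k, a (k + 2) = t * a (k + 1) - a k)
    (k : ℕ) : (reflection hf * reflection hg) (a (k + 1) • x + a k • y) =
      a (k + 3) • x + a (k + 2) • y := by
  rw [ha (k + 1), ha k, LinearEquiv.mul_apply]
  simp only [reflection_apply, map_add, map_sub, map_smul, hf, hg, hfy, hgx]
  module

theorem reflection_mul_reflection_pow_apply_of_recurrence (hf : f x = 2) (hg : g y = 2) {t : R}
    (hfy : f y = -t) (hgx : g x = -t) {a : ℕ → R} (ha : ∀ k, a (k + 2) = t * a (k + 1) - a k)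
    (p : ℕ) : ((reflection hf * reflection hg) ^ p) (a 1 • x + a 0 • y) =
      a (2 * p + 1) • x + a (2 * p) • y := by
  induction p with
  | zero => simp
  | succ p ih =>
    rw [pow_succ', LinearEquiv.mul_apply, ih,
      reflection_mul_reflection_apply_of_recurrence hf hg hfy hgx ha]
    rfl

theorem reflection_mul_reflection_pow_apply_of_apply_eq_zero (hf : f x = 2) (hg : g y = 2) {z : V}
    (hfz : f z = 0) (hgz : g z = 0) (p : ℕ) :
    ((reflection hf * reflection hg) ^ p) z = z := by
  have hz : (reflection hf * reflection hg) z = z := by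
    simp [LinearEquiv.mul_apply, reflection_apply, hfz, hgz]
  induction p with
  | zero => simp
  | succ p ih => rw [pow_succ', LinearEquiv.mul_apply, ih, hz]

end Reflections

section DihedralReflections

open Module Real

theorem sin_nat_add_two_mul_add (θ φ : ℝ) (k : ℕ) : sin ((k + 2 : ℕ) * θ + φ) =
    2 * cos θ * sin ((k + 1 : ℕ) * θ + φ) - sin (k * θ + φ) := by
  have h₁ : ((k + 2 : ℕ) * θ + φ) = ((k + 1 : ℕ) * θ + φ) + θ := by push_cast; ring
  have h₂ : (k * θ + φ) = ((k + 1 : ℕ) * θ + φ) - θ := by push_cast; ring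
  rw [h₁, h₂, sin_add, sin_sub]
  ring

theorem sin_pi_div_natCast_pos {m : ℕ} (hm : 2 ≤ m) : 0 < sin (π / m) := by
  have hm' : (2 : ℝ) ≤ m := by exact_mod_cast hm
  have hle : π / m ≤ π / 2 := by gcongr
  exact sin_pos_of_pos_of_lt_pi (by positivity) (by linarith [pi_pos])

variable {V : Type*} [AddCommGroup V] [Module ℝ V] {x y : V} {f g : Dual ℝ V} {m : ℕ}
  (hf : f x = 2) (hg : g y = 2) (hfy : f y = -(2 * cos (π / m))) (hgx : g x = -(2 * cos (π / m)))

include hfy hgx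

theorem reflection_mul_reflection_pow_apply_sin (p : ℕ) (φ : ℝ) :
    ((reflection hf * reflection hg) ^ p) (sin (π / m + φ) • x + sin φ • y) =
      sin ((2 * p + 1) * (π / m) + φ) • x + sin (2 * p * (π / m) + φ) • y := by
  simpa using reflection_mul_reflection_pow_apply_of_recurrence hf hg hfy hgx
    (a := fun k : ℕ => sin (k * (π / m) + φ)) (sin_nat_add_two_mul_add (π / m) φ) p

theorem reflection_mul_reflection_pow_eq_one (hm : 2 ≤ m) :
    (reflection hf * reflection hg) ^ m = 1 := by
  have hs : sin (π / m) ≠ 0 := (sin_pi_div_natCast_pos hm).ne'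
  have hπ : 2 * m * (π / m) = 2 * π := by
    have : (m : ℝ) ≠ 0 := by positivity
    field_simp
  have hperiod (φ : ℝ) : ((reflection hf * reflection hg) ^ m)
      (sin (π / m + φ) • x + sin φ • y) = sin (π / m + φ) • x + sin φ • y := by
    rw [reflection_mul_reflection_pow_apply_sin hf hg hfy hgx, add_mul, hπ, one_mul, add_assoc,
      add_comm (2 * π), add_comm (2 * π), sin_add_two_pi, sin_add_two_pi]
  have hx : ((reflection hf * reflection hg) ^ m) x = x := by
    simpa [hs] using hperiod 0
  have hy : ((reflection hf * reflection hg) ^ m) y = y := by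
    simpa [hs] using hperiod (-(π / m))
  ext z
  obtain ⟨α, hα⟩ : ∃ α, α = (f z + cos (π / m) * g z) / (2 * sin (π / m) ^ 2) := ⟨_, rfl⟩
  obtain ⟨β, hβ⟩ : ∃ β, β = (cos (π / m) * f z + g z) / (2 * sin (π / m) ^ 2) := ⟨_, rfl⟩
  have hfz : f (z - (α • x + β • y)) = 0 := by
    simp only [map_sub, map_add, map_smul, hf, hfy, smul_eq_mul, hα, hβ]
    field_simp
    rw [sin_sq]
    ring
  have hgz : g (z - (α • x + β • y)) = 0 := by
    simp only [map_sub, map_add, map_smul, hg, hgx, smul_eq_mul, hα, hβ]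
    field_simp
    rw [sin_sq]
    ring
  rw [← sub_add_cancel z (α • x + β • y), map_add, map_add, map_smul, map_smul, hx, hy,
    reflection_mul_reflection_pow_apply_of_apply_eq_zero hf hg hfz hgz, LinearEquiv.coe_one, id]

theorem dvd_of_reflection_mul_reflection_pow_eq_one (hm : m ≠ 1)
    (hxy : LinearIndependent ℝ ![x, y]) {p : ℕ} (hp : (reflection hf * reflection hg) ^ p = 1) :
    m ∣ p := by
  rw [LinearIndependent.pair_iff] at hxy
  obtain rfl | hm : m = 0 ∨ 2 ≤ m := by lia
  · have h := reflection_mul_reflection_pow_apply_of_recurrence hf hg hfy hgx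
      (a := fun k => (k : ℝ)) (fun k => by push_cast; simp; ring) p
    rw [hp, ← sub_eq_zero] at h
    have := (hxy (-(2 * p)) (-(2 * p)) (by rw [← h]; simp; module)).1
    simpa using this
  · have hs : sin (π / m) ≠ 0 := (sin_pi_div_natCast_pos hm).ne'
    have h := reflection_mul_reflection_pow_apply_sin hf hg hfy hgx p 0
    rw [hp, ← sub_eq_zero, LinearEquiv.coe_one, id, add_sub_add_comm, ← sub_smul, ← sub_smul] at h
    obtain ⟨h₁, h₀⟩ := hxy _ _ h
    have hsin : sin (2 * p * (π / m)) = 0 := by simpa using h₀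
    have hcos : cos (2 * p * (π / m)) = 1 := by
      rw [add_zero, add_zero, add_mul, one_mul, sin_add, hsin, zero_mul, zero_add] at h₁
      exact mul_right_cancel₀ hs (by linarith)
    obtain ⟨n, hn⟩ := (cos_eq_one_iff _).mp hcos
    have hpn : (p : ℝ) = m * n := by
      have : (m : ℝ) ≠ 0 := by positivity
      have := pi_pos
      field_simp at hn
      linarith
    have : (p : ℤ) = m * n := by exact_mod_cast hpn
    exact_mod_cast Dvd.intro n this.symm

end DihedralReflections

section GeometricRepresentation

open Module Real

variable {B W : Type*} [Group W] {M : CoxeterMatrix B}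

variable (M) in
/-- The simple coroot `α ↦ 2⟨α_i, α⟩` of the geometric representation of a Coxeter group, whose
simple roots `α_j` are the basis vectors of `B →₀ ℝ`. An entry `M i j = 0`, which stands for `∞`,
needs no special treatment: then `π / M i j = 0`, so that `⟨α_i, α_j⟩ = -1`. -/
noncomputable def simpleCoroot (i : B) : Dual ℝ (B →₀ ℝ) :=
  Finsupp.linearCombination ℝ fun j => -(2 * cos (π / M i j))

theorem simpleCoroot_single (i j : B) :
    simpleCoroot M i (Finsupp.single j 1) = -(2 * cos (π / M i j)) := by
  simp [simpleCoroot]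

theorem simpleCoroot_single_self (i : B) : simpleCoroot M i (Finsupp.single i 1) = 2 := by
  simp [simpleCoroot_single]

variable (M) in
/-- The simple reflections of the geometric representation. -/
noncomputable def simpleReflection (i : B) : (B →₀ ℝ) ≃ₗ[ℝ] (B →₀ ℝ) :=
  reflection (simpleCoroot_single_self (M := M) i)

theorem isLiftable_simpleReflection : M.IsLiftable (simpleReflection M) := by
  intro i j
  rcases eq_or_ne i j with rfl | hij
  · ext1 z
    simp [simpleReflection, LinearEquiv.mul_apply, involutive_reflection _ z]
  · obtain h | h : M i j = 0 ∨ 2 ≤ M i j := by have := M.off_diagonal i j hij; lia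
    · rw [h, pow_zero]
    · exact reflection_mul_reflection_pow_eq_one _ _ (simpleCoroot_single i j)
        (M.symmetric i j ▸ simpleCoroot_single j i) h

theorem dvd_of_simpleReflection_mul_simpleReflection_pow_eq_one {i j : B} (hij : i ≠ j) {p : ℕ}
    (hp : (simpleReflection M i * simpleReflection M j) ^ p = 1) : M i j ∣ p := by
  refine dvd_of_reflection_mul_reflection_pow_eq_one _ _ (simpleCoroot_single i j)
    (M.symmetric i j ▸ simpleCoroot_single j i) (M.off_diagonal i j hij) ?_ hp
  refine LinearIndependent.pair_iff.mpr fun a b h => ?_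
  have hi := DFunLike.congr_fun h i
  have hj := DFunLike.congr_fun h j
  simpa [hij, hij.symm] using And.intro hi hj

theorem orderOf_simple_mul_simple (cs : CoxeterSystem M W) (i j : B) :
    orderOf (cs.simple i * cs.simple j) = M i j := by
  rcases eq_or_ne i j with rfl | hij
  · simp
  refine Nat.dvd_antisymm (orderOf_dvd_of_pow_eq_one (cs.simple_mul_simple_pow i j)) ?_
  apply dvd_of_simpleReflection_mul_simpleReflection_pow_eq_one hij
  have h := congrArg (cs.lift ⟨_, isLiftable_simpleReflection⟩)
    (pow_orderOf_eq_one (cs.simple i * cs.simple j))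
  simpa only [map_pow, map_mul, cs.lift_apply_simple, map_one] using h

end GeometricRepresentation

/-! ### Newman's lemma -/

section Newman

open Relation

variable {α : Type*} {r : α → α → Prop}

theorem exists_forall_reflTransGen_of_locallyConfluent (hr : WellFounded (flip r))
    (hloc : ∀ a b c, r a b → r a c → ∃ d, ReflTransGen r b d ∧ ReflTransGen r c d) (a : α) :
    ∃ d, ReflTransGen r a d ∧ ∀ x, ReflTransGen r a x → ReflTransGen r x d := by
  induction a using hr.induction with
  | _ a ih =>
    by_cases hmax : ∃ b, r a b
    · obtain ⟨b, hab⟩ := hmax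
      obtain ⟨d, hbd, hd⟩ := ih b hab
      refine ⟨d, hbd.head hab, fun x hx => ?_⟩
      rcases hx.cases_head with rfl | ⟨c, hac, hcx⟩
      · exact hbd.head hab
      · obtain ⟨e, hbe, hce⟩ := hloc a b c hab hac
        obtain ⟨d', -, hd'⟩ := ih c hac
        exact (hd' x hcx).trans (hd d' (hbe.trans (hd' e hce)))
    · refine ⟨a, .refl, fun x hx => ?_⟩
      rcases hx.cases_head with rfl | ⟨c, hac, -⟩
      · exact .refl
      · exact absurd ⟨c, hac⟩ hmax

end Newman

open CoxeterSystem

variable {B W : Type*} [Group W] {M : CoxeterMatrix B} (cs : CoxeterSystem M W)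

/-! ### The exchange property -/

section InversionSequences

open List

theorem prod_map_alternatingWord_two_mul {N : Type*} [Monoid N] (f : B → N) (i j : B) (m : ℕ) :
    ((alternatingWord i j (2 * m)).map f).prod = (f i * f j) ^ m := by
  induction m with
  | zero => simp [alternatingWord]
  | succ m ih =>
    rw [mul_add, mul_one, alternatingWord_succ, alternatingWord_succ, concat_eq_append,
      concat_eq_append, map_append, map_append, prod_append, prod_append, ih, pow_succ]
    simp [mul_assoc]

theorem reverse_rightInvSeq_alternatingWord (i j : B) (p : ℕ) :
    (cs.rightInvSeq (alternatingWord i j p)).reverse =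
      (range p).map fun k => (cs.simple j * cs.simple i) ^ k * cs.simple j := by
  induction p generalizing i j with
  | zero => simp [alternatingWord]
  | succ p ih =>
    have hconj (k : ℕ) : cs.simple j * ((cs.simple i * cs.simple j) ^ k * cs.simple i) *
        cs.simple j = (cs.simple j * cs.simple i) ^ (k + 1) * cs.simple j := by
      have h : SemiconjBy (cs.simple j) (cs.simple i * cs.simple j)
          (cs.simple j * cs.simple i) := (mul_assoc _ _ _).symm
      rw [← mul_assoc, (h.pow_right k).eq, pow_succ]
      simp only [mul_assoc]
    rw [alternatingWord_succ, rightInvSeq_concat, concat_eq_append, reverse_append, ← map_reverse,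
      ih, range_succ_eq_map]
    simp [hconj, Function.comp_def]

open scoped Classical in
/-- The permutation of `W × ℤ/2` that conjugates the first entry by a simple reflection and changes
the sign exactly at this reflection. Its extension to `W` counts, modulo two, the occurrences of a
reflection in an inversion sequence. -/
noncomputable def signedConj (i : B) : Equiv.Perm (W × ZMod 2) :=
  Function.Involutive.toPerm
    (fun p => (cs.simple i * p.1 * cs.simple i, p.2 + if p.1 = cs.simple i then 1 else 0)) (by
    rintro ⟨t, e⟩
    have h : cs.simple i * t * cs.simple i = cs.simple i ↔ t = cs.simple i := by
      rw [mul_eq_right, mul_eq_one_iff_eq_inv', inv_simple]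
    simp only [h, add_assoc, CharTwo.add_self_eq_zero, add_zero]
    simp [mul_assoc])

open scoped Classical in
theorem signedConj_apply (i : B) (t : W) (e : ZMod 2) : signedConj cs i (t, e) =
    (cs.simple i * t * cs.simple i, e + if t = cs.simple i then 1 else 0) :=
  rfl

open scoped Classical in
theorem prod_map_signedConj_apply (ω : List B) (t : W) (e : ZMod 2) :
    (ω.map (signedConj cs)).prod (t, e) =
      (cs.wordProd ω * t * (cs.wordProd ω)⁻¹, e + ((cs.rightInvSeq ω).count t : ℕ)) := by
  induction ω with
  | nil => simp
  | cons i ω ih =>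
    have h : (cs.wordProd ω)⁻¹ * cs.simple i * cs.wordProd ω = t ↔
        cs.wordProd ω * t * (cs.wordProd ω)⁻¹ = cs.simple i := by
      rw [mul_inv_eq_iff_eq_mul, mul_assoc, inv_mul_eq_iff_eq_mul, eq_comm]
    rw [map_cons, prod_cons, Equiv.Perm.mul_apply, ih, signedConj_apply]
    simp only [wordProd_cons, rightInvSeq, count_cons, beq_iff_eq, h]
    simp [mul_assoc, add_assoc]

open scoped Classical in
theorem even_count_rightInvSeq_alternatingWord (i j : B) (t : W) :
    Even ((cs.rightInvSeq (alternatingWord i j (2 * M i j))).count t) := by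
  rw [← count_reverse, reverse_rightInvSeq_alternatingWord, two_mul, range_add, map_append,
    map_map, count_append]
  simp [Function.comp_def, pow_add]

theorem isLiftable_signedConj : M.IsLiftable (signedConj cs) := by
  classical
  intro i j
  ext1 ⟨t, e⟩
  have hcount : ((cs.rightInvSeq (alternatingWord i j (2 * M i j))).count t : ZMod 2) = 0 :=
    ZMod.natCast_eq_zero_iff_even.mpr (even_count_rightInvSeq_alternatingWord cs i j t)
  have hπ : cs.wordProd (alternatingWord i j (2 * M i j)) = 1 := by
    rw [wordProd, prod_map_alternatingWord_two_mul, simple_mul_simple_pow]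
  rw [← prod_map_alternatingWord_two_mul, prod_map_signedConj_apply, hcount, hπ]
  simp

open scoped Classical in
theorem natCast_count_rightInvSeq_eq {ω ω' : List B} (h : cs.wordProd ω = cs.wordProd ω') (t : W) :
    ((cs.rightInvSeq ω).count t : ZMod 2) = (cs.rightInvSeq ω').count t := by
  have hlift (ω : List B) : cs.lift ⟨_, isLiftable_signedConj cs⟩ (cs.wordProd ω) =
      (ω.map (signedConj cs)).prod := by
    rw [wordProd, map_list_prod, map_map]
    exact congrArg prod (map_congr_left fun i _ => cs.lift_apply_simple _ i)
  have heq := congrArg (fun f : Equiv.Perm (W × ZMod 2) => (f (t, 0)).2)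
    ((hlift ω).symm.trans ((congrArg _ h).trans (hlift ω')))
  simpa only [prod_map_signedConj_apply, zero_add] using heq

theorem rightInvSeq_subset {ω ω' : List B} (hω : (cs.rightInvSeq ω).Nodup)
    (h : cs.wordProd ω = cs.wordProd ω') : cs.rightInvSeq ω ⊆ cs.rightInvSeq ω' := by
  classical
  intro t ht
  have hcount := natCast_count_rightInvSeq_eq cs h t
  rw [count_eq_one_of_mem hω ht] at hcount
  by_contra hn
  rw [count_eq_zero_of_not_mem hn] at hcount
  simp at hcount

theorem isReduced_of_nodup_rightInvSeq {ω : List B} (hω : (cs.rightInvSeq ω).Nodup) :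
    cs.IsReduced ω := by
  obtain ⟨ω', hω', h⟩ := cs.exists_isReduced (cs.wordProd ω)
  have hle := (hω.subperm (rightInvSeq_subset cs hω h)).length_le
  rw [length_rightInvSeq, length_rightInvSeq, ← hω'.eq, ← h] at hle
  exact le_antisymm (cs.length_wordProd_le ω) hle

theorem exists_isReduced_concat_of_isRightDescent {w : W} {i : B} (h : cs.IsRightDescent w i) :
    ∃ ω : List B, cs.IsReduced (ω.concat i) ∧ cs.wordProd (ω.concat i) = w := by
  obtain ⟨ω, hω, hw⟩ := cs.exists_isReduced (w * cs.simple i)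
  have hp : cs.wordProd (ω.concat i) = w := by rw [wordProd_concat, ← hw]; simp
  refine ⟨ω, ?_, hp⟩
  rw [isRightDescent_iff] at h
  rw [CoxeterSystem.IsReduced, hp, ← h, hw, hω.eq, length_concat]

theorem simple_mem_rightInvSeq {ω : List B} {i : B} (h : cs.IsRightDescent (cs.wordProd ω) i) :
    cs.simple i ∈ cs.rightInvSeq ω := by
  obtain ⟨ω', hω', hπ⟩ := exists_isReduced_concat_of_isRightDescent cs h
  apply rightInvSeq_subset cs hω'.nodup_rightInvSeq hπ
  rw [rightInvSeq_concat]
  simp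

theorem simple_mem_leftInvSeq {ω : List B} {i : B} (h : cs.IsLeftDescent (cs.wordProd ω) i) :
    cs.simple i ∈ cs.leftInvSeq ω := by
  rw [← isRightDescent_inv_iff, ← wordProd_reverse] at h
  simpa only [rightInvSeq_reverse, mem_reverse] using simple_mem_rightInvSeq cs h

theorem exists_simple_mul_wordProd_eq_eraseIdx {ω : List B} {i : B}
    (h : cs.IsLeftDescent (cs.wordProd ω) i) :
    ∃ j < ω.length, cs.simple i * cs.wordProd ω = cs.wordProd (ω.eraseIdx j) := by
  obtain ⟨j, hj, hij⟩ := mem_iff_getElem.mp (simple_mem_leftInvSeq cs h)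
  refine ⟨j, by simpa using hj, ?_⟩
  rw [← getD_leftInvSeq_mul_wordProd, getD_eq_getElem _ _ hj, hij]

theorem length_wordProd_eraseIdx_lt {ω : List B} {k : ℕ} (hk : k < ω.length) :
    cs.length (cs.wordProd (ω.eraseIdx k)) < ω.length := by
  have := cs.length_wordProd_le (ω.eraseIdx k)
  rw [length_eraseIdx_of_lt hk] at this
  lia

theorem exists_simple_mul_mul_eq {x b : W} {i : B} (hx : ¬cs.IsLeftDescent x i)
    (hxb : cs.IsLeftDescent (x * b) i) :
    ∃ b', cs.length b' < cs.length b ∧ cs.simple i * (x * b) = x * b' := by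
  obtain ⟨ω, hω, rfl⟩ := cs.exists_isReduced x
  obtain ⟨τ, hτ, rfl⟩ := cs.exists_isReduced b
  rw [← wordProd_append] at hxb
  obtain ⟨k, hk, heq⟩ := exists_simple_mul_wordProd_eq_eraseIdx cs hxb
  rcases lt_or_ge k ω.length with hkω | hkω
  · rw [eraseIdx_append_of_lt_length hkω, wordProd_append, wordProd_append, ← mul_assoc,
      mul_left_inj] at heq
    have hlt := length_wordProd_eraseIdx_lt cs hkω
    rw [← heq, ← hω.eq] at hlt
    exact absurd hlt hx
  · rw [length_append] at hk
    rw [eraseIdx_append_of_length_le hkω, wordProd_append, wordProd_append] at heq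
    refine ⟨_, ?_, heq⟩
    rw [hτ.eq]
    exact length_wordProd_eraseIdx_lt cs (by lia)

end InversionSequences

/-! ### Reduced products and parabolic subgroups -/

section ReducedProducts

/-- The lengths of `a` and `b` add up in the product `a * b`, that is, the product is defined in
the derived germ. -/
def LengthAdd (a b : W) : Prop :=
  cs.length (a * b) = cs.length a + cs.length b

theorem lengthAdd_one (a : W) : LengthAdd cs a 1 := by simp [LengthAdd]

theorem lengthAdd_assoc {a b c : W} : LengthAdd cs a b ∧ LengthAdd cs (a * b) c ↔
    LengthAdd cs b c ∧ LengthAdd cs a (b * c) := by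
  have h₁ := cs.length_mul_le a b
  have h₂ := cs.length_mul_le b c
  have h₃ := cs.length_mul_le (a * b) c
  have h₄ := cs.length_mul_le a (b * c)
  simp only [LengthAdd, mul_assoc] at *
  lia

theorem lengthAdd_inv_inv {a b : W} : LengthAdd cs b⁻¹ a⁻¹ ↔ LengthAdd cs a b := by
  simp only [LengthAdd, ← mul_inv_rev, length_inv, add_comm]

theorem simple_lengthAdd_iff {w : W} {i : B} :
    LengthAdd cs (cs.simple i) w ↔ ¬cs.IsLeftDescent w i := by
  rw [not_isLeftDescent_iff, LengthAdd, length_simple, add_comm]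

theorem lengthAdd_simple_iff {w : W} {i : B} :
    LengthAdd cs w (cs.simple i) ↔ ¬cs.IsRightDescent w i := by
  rw [not_isRightDescent_iff, LengthAdd, length_simple]

theorem isReduced_append_iff {ω τ : List B} : cs.IsReduced (ω ++ τ) ↔
    cs.IsReduced ω ∧ cs.IsReduced τ ∧ LengthAdd cs (cs.wordProd ω) (cs.wordProd τ) := by
  have hω := cs.length_wordProd_le ω
  have hτ := cs.length_wordProd_le τ
  have h := cs.length_mul_le (cs.wordProd ω) (cs.wordProd τ)
  simp only [CoxeterSystem.IsReduced, LengthAdd, wordProd_append, List.length_append]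
  lia

theorem isReduced_singleton (i : B) : cs.IsReduced [i] := by simp [CoxeterSystem.IsReduced]

theorem isReduced_cons_iff {i : B} {ω : List B} : cs.IsReduced (i :: ω) ↔
    cs.IsReduced ω ∧ ¬cs.IsLeftDescent (cs.wordProd ω) i := by
  simpa [isReduced_singleton, simple_lengthAdd_iff] using
    isReduced_append_iff cs (ω := [i]) (τ := ω)

theorem isReduced_concat_iff {i : B} {ω : List B} : cs.IsReduced (ω.concat i) ↔
    cs.IsReduced ω ∧ ¬cs.IsRightDescent (cs.wordProd ω) i := by
  simpa [isReduced_singleton, lengthAdd_simple_iff] using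
    isReduced_append_iff cs (ω := ω) (τ := [i])

theorem isRightDescent_wordProd_concat {ω : List B} {i : B} (h : cs.IsReduced (ω.concat i)) :
    cs.IsRightDescent (cs.wordProd (ω.concat i)) i := by
  rw [isReduced_concat_iff, not_isRightDescent_iff] at h
  rw [wordProd_concat, isRightDescent_iff, simple_mul_simple_cancel_right, h.2]

end ReducedProducts

section Parabolic

/-- The standard parabolic subgroup `W_I` of the group of a Coxeter system. -/
def standardParabolic (I : Set B) : Subgroup W :=
  Subgroup.closure (cs.simple '' I)

variable {I : Set B}

theorem simple_mem_standardParabolic {i : B} (hi : i ∈ I) :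
    cs.simple i ∈ standardParabolic cs I :=
  Subgroup.subset_closure (Set.mem_image_of_mem _ hi)

variable {cs} in
@[elab_as_elim]
theorem standardParabolic_induction {p : (x : W) → x ∈ standardParabolic cs I → Prop}
    (one : p 1 (one_mem _))
    (simple_mul : ∀ i (hi : i ∈ I) x hx, p x hx →
      p (cs.simple i * x) (mul_mem (simple_mem_standardParabolic cs hi) hx))
    {x : W} (hx : x ∈ standardParabolic cs I) : p x hx := by
  induction hx using Subgroup.closure_induction_left with
  | one => exact one
  | mul_left x hx y hy ih =>
    obtain ⟨i, hi, rfl⟩ := hx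
    exact simple_mul i hi y hy ih
  | inv_mul_cancel x hx y hy ih =>
    obtain ⟨i, hi, rfl⟩ := hx
    simpa only [inv_simple] using simple_mul i hi y hy ih

theorem exists_isReduced_of_mem_standardParabolic {x : W} (hx : x ∈ standardParabolic cs I) :
    ∃ ω : List B, (∀ i ∈ ω, i ∈ I) ∧ cs.IsReduced ω ∧ cs.wordProd ω = x := by
  induction hx using standardParabolic_induction with
  | one => exact ⟨[], by simp, by simp [CoxeterSystem.IsReduced], cs.wordProd_nil⟩
  | simple_mul i hi x hx ih =>
    obtain ⟨ω, hω, hred, rfl⟩ := ih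
    by_cases hd : cs.IsLeftDescent (cs.wordProd ω) i
    · obtain ⟨k, hk, hk'⟩ := exists_simple_mul_wordProd_eq_eraseIdx cs hd
      refine ⟨ω.eraseIdx k, fun j hj => hω j (List.mem_of_mem_eraseIdx hj), ?_, hk'.symm⟩
      rw [isLeftDescent_iff, hred.eq, hk'] at hd
      rw [CoxeterSystem.IsReduced, List.length_eraseIdx_of_lt hk]
      lia
    · exact ⟨i :: ω, by simpa using ⟨hi, hω⟩, (isReduced_cons_iff cs).mpr ⟨hred, hd⟩,
        cs.wordProd_cons i ω⟩

theorem exists_isLeftDescent_of_mem_standardParabolic {x : W} (hx : x ∈ standardParabolic cs I)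
    (hx₁ : x ≠ 1) : ∃ i ∈ I, cs.IsLeftDescent x i := by
  obtain ⟨_ | ⟨i, ω⟩, hω, hred, rfl⟩ := exists_isReduced_of_mem_standardParabolic cs hx
  · exact absurd cs.wordProd_nil hx₁
  · refine ⟨i, hω i (by simp), ?_⟩
    have := (isReduced_cons_iff cs).mp hred
    rw [IsLeftDescent, hred.eq, wordProd_cons, simple_mul_simple_cancel_left, this.1.eq]
    simp

theorem lengthAdd_of_forall_length_le {b : W}
    (hb : ∀ y ∈ standardParabolic cs I, cs.length b ≤ cs.length (y * b)) {x : W}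
    (hx : x ∈ standardParabolic cs I) : LengthAdd cs x b := by
  induction hx using standardParabolic_induction with
  | one => simp [LengthAdd]
  | simple_mul i hi x hx ih =>
    rw [LengthAdd] at ih ⊢
    by_cases hd : cs.IsLeftDescent x i
    · have hle := cs.length_mul_le (cs.simple i * x) b
      have hge := cs.length_mul_le (cs.simple i) (cs.simple i * x * b)
      rw [isLeftDescent_iff] at hd
      rw [mul_assoc, simple_mul_simple_cancel_left, length_simple, ← mul_assoc] at hge
      lia
    · have hdb : ¬cs.IsLeftDescent (x * b) i := by
        intro hdb
        obtain ⟨b', hlt, heq⟩ := exists_simple_mul_mul_eq cs hd hdb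
        have hmem : x⁻¹ * cs.simple i * x ∈ standardParabolic cs I :=
          mul_mem (mul_mem (inv_mem hx) (simple_mem_standardParabolic cs hi)) hx
        have hle := hb _ hmem
        rw [mul_assoc, mul_assoc, heq, inv_mul_cancel_left] at hle
        exact hle.not_gt hlt
      rw [not_isLeftDescent_iff] at hd hdb
      rw [mul_assoc, hdb, hd, ih]
      lia

variable (I) in
theorem exists_mem_standardParabolic_mul_eq (u : W) : ∃ x ∈ standardParabolic cs I, ∃ b,
    (∀ y ∈ standardParabolic cs I, LengthAdd cs y b) ∧ x * b = u := by
  obtain ⟨z, hz, hmin⟩ := (measure fun z => cs.length (z * u)).wf.has_min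
    (standardParabolic cs I : Set W) ⟨1, one_mem _⟩
  refine ⟨z⁻¹, inv_mem hz, z * u, fun y hy => ?_, inv_mul_cancel_left z u⟩
  refine lengthAdd_of_forall_length_le cs (fun t ht => not_lt.mp ?_) hy
  rw [← mul_assoc]
  exact hmin (t * z) (mul_mem ht hz)

theorem isLeftDescent_mul_iff {x b : W} (hx : x ∈ standardParabolic cs I)
    (hb : ∀ y ∈ standardParabolic cs I, LengthAdd cs y b) {i : B} (hi : i ∈ I) :
    cs.IsLeftDescent (x * b) i ↔ cs.IsLeftDescent x i := by
  have h := hb _ (mul_mem (simple_mem_standardParabolic cs hi) hx)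
  rw [LengthAdd, mul_assoc] at h
  rw [IsLeftDescent, h, hb x hx, add_lt_add_iff_right, IsLeftDescent]

theorem lengthAdd_of_forall_not_isLeftDescent {w : W} (hw : ∀ i ∈ I, ¬cs.IsLeftDescent w i)
    {x : W} (hx : x ∈ standardParabolic cs I) : LengthAdd cs x w := by
  obtain ⟨y, hy, b, hb, rfl⟩ := exists_mem_standardParabolic_mul_eq cs I w
  obtain rfl : y = 1 := by
    by_contra hy₁
    obtain ⟨i, hi, hd⟩ := exists_isLeftDescent_of_mem_standardParabolic cs hy hy₁
    exact hw i hi ((isLeftDescent_mul_iff cs hy hb hi).mpr hd)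
  rw [one_mul]
  exact hb x hx

theorem lengthAdd_of_forall_not_isRightDescent {w : W} (hw : ∀ i ∈ I, ¬cs.IsRightDescent w i)
    {x : W} (hx : x ∈ standardParabolic cs I) : LengthAdd cs w x := by
  rw [← lengthAdd_inv_inv]
  exact lengthAdd_of_forall_not_isLeftDescent cs
    (fun i hi => (cs.isLeftDescent_inv_iff).not.mpr (hw i hi)) (inv_mem hx)

end Parabolic

section Dihedral

variable {i j : B}

theorem isReduced_alternatingWord (i j : B) {p : ℕ} (hp : M i j = 0 ∨ p ≤ M i j) :
    cs.IsReduced (alternatingWord i j p) := by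
  apply isReduced_of_nodup_rightInvSeq
  rw [← List.nodup_reverse, reverse_rightInvSeq_alternatingWord]
  refine List.nodup_range.map_on fun k hk l hl h => ?_
  rw [mul_left_inj, pow_inj_mod, orderOf_simple_mul_simple, M.symmetric j i] at h
  rw [List.mem_range] at hk hl
  rcases hp with hM | hM
  · simpa [hM] using h
  · rwa [Nat.mod_eq_of_lt (hk.trans_le hM), Nat.mod_eq_of_lt (hl.trans_le hM)] at h

theorem eq_alternatingWord_of_isReduced {ω : List B} (hω : ∀ k ∈ ω, k = i ∨ k = j)
    (hred : cs.IsReduced ω) :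
    ω = alternatingWord i j ω.length ∨ ω = alternatingWord j i ω.length := by
  have concat_eq {ω : List B} {a b : B} (hred : cs.IsReduced (ω.concat b))
      (h : ω = alternatingWord a b ω.length ∨ ω = alternatingWord b a ω.length) :
      ω.concat b = alternatingWord a b (ω.concat b).length := by
    rw [List.length_concat, alternatingWord_succ]
    rcases h with h | h
    · cases hn : ω.length with
      | zero => rw [List.length_eq_zero_iff.mp hn]; simp [alternatingWord]
      | succ n =>
        rw [hn, alternatingWord_succ] at h
        obtain ⟨hω, hd⟩ := (isReduced_concat_iff cs).mp hred
        rw [h] at hω hd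
        exact absurd (isRightDescent_wordProd_concat cs hω) hd
    · rw [← h]
  induction ω using List.reverseRecOn with
  | nil => simp [alternatingWord]
  | append_singleton ω k ih =>
    rw [← List.concat_eq_append] at hred ⊢
    have ih' := ih (fun l hl => hω l (by simp [hl])) ((isReduced_concat_iff cs).mp hred).1
    rcases hω k (by simp) with rfl | rfl
    · exact Or.inr (concat_eq hred ih'.symm)
    · exact Or.inl (concat_eq hred ih')

theorem eq_of_isRightDescent_wordProd_alternatingWord {p : ℕ}
    (hred : cs.IsReduced (alternatingWord i j p))
    (hd : cs.IsRightDescent (cs.wordProd (alternatingWord i j p)) i) : M i j ≠ 0 ∧ p = M i j := by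
  have hnot : ¬cs.IsReduced (alternatingWord j i (p + 1)) := by
    rw [alternatingWord_succ, isReduced_concat_iff]
    exact fun h => h.2 hd
  have h := mt (isReduced_alternatingWord cs j i) hnot
  rw [M.symmetric j i] at h
  push Not at h
  refine ⟨h.1, le_antisymm (not_lt.mp fun hlt => ?_) (by lia)⟩
  exact cs.not_isReduced_alternatingWord i j h.1 hlt hred

theorem eq_wordProd_braidWord_of_isRightDescent {x : W} (hx : x ∈ standardParabolic cs {i, j})
    (hi : cs.IsRightDescent x i) (hj : cs.IsRightDescent x j) :
    M i j ≠ 0 ∧ x = cs.wordProd (braidWord M i j) := by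
  obtain ⟨ω, hω, hred, rfl⟩ := exists_isReduced_of_mem_standardParabolic cs hx
  rcases eq_alternatingWord_of_isReduced cs hω hred with h | h
  · rw [h] at hred hi ⊢
    obtain ⟨hM, hlen⟩ := eq_of_isRightDescent_wordProd_alternatingWord cs hred hi
    exact ⟨hM, by rw [hlen, braidWord]⟩
  · rw [h] at hred hj ⊢
    obtain ⟨hM, hlen⟩ := eq_of_isRightDescent_wordProd_alternatingWord cs hred hj
    exact ⟨M.symmetric i j ▸ hM, by rw [hlen, wordProd_braidWord_eq, braidWord]⟩

theorem exists_lengthAdd_wordProd_braidWord {u : W} (hi : cs.IsRightDescent u i)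
    (hj : cs.IsRightDescent u j) : M i j ≠ 0 ∧
      ∃ b, LengthAdd cs b (cs.wordProd (braidWord M i j)) ∧
        b * cs.wordProd (braidWord M i j) = u := by
  obtain ⟨x, hx, b, hb, hu⟩ := exists_mem_standardParabolic_mul_eq cs {i, j} u⁻¹
  have isRightDescent_inv (k : B) (hk : k ∈ ({i, j} : Set B)) (hd : cs.IsRightDescent u k) :
      cs.IsRightDescent x⁻¹ k := by
    rw [isRightDescent_inv_iff]
    rw [← isLeftDescent_inv_iff, ← hu] at hd
    exact (isLeftDescent_mul_iff cs hx hb hk).mp hd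
  obtain ⟨hM, hx'⟩ := eq_wordProd_braidWord_of_isRightDescent cs (inv_mem hx)
    (isRightDescent_inv i (by simp) hi) (isRightDescent_inv j (by simp) hj)
  refine ⟨hM, b⁻¹, ?_, ?_⟩
  · rw [← hx', lengthAdd_inv_inv]
    exact hb x hx
  · rw [← hx', ← mul_inv_rev, hu, inv_inv]

end Dihedral

/-! ### Greatest prefixes -/

section Prefixes

variable {u v w a b c : W} {i : B}

theorem mul_eq_some_iff : cs.derivedGerm.mul a b = some c ↔ LengthAdd cs a b ∧ a * b = c := by
  simp [derivedGerm, LengthAdd]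

theorem isPrefix_iff : cs.derivedGerm.IsPrefix u v ↔ ∃ b, LengthAdd cs u b ∧ u * b = v := by
  simp only [Germ.IsPrefix, mul_eq_some_iff]

variable {cs} in
theorem LengthAdd.isPrefix (h : LengthAdd cs a b) : cs.derivedGerm.IsPrefix a (a * b) :=
  (isPrefix_iff cs).mpr ⟨b, h, rfl⟩

theorem isPrefix_refl (u : W) : cs.derivedGerm.IsPrefix u u := by
  simpa using (lengthAdd_one cs u).isPrefix

theorem one_isPrefix (u : W) : cs.derivedGerm.IsPrefix 1 u :=
  (isPrefix_iff cs).mpr ⟨u, by simp [LengthAdd], one_mul u⟩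

variable {cs} in
theorem isPrefix_trans (huv : cs.derivedGerm.IsPrefix u v) (hvw : cs.derivedGerm.IsPrefix v w) :
    cs.derivedGerm.IsPrefix u w := by
  obtain ⟨b, hb, rfl⟩ := (isPrefix_iff cs).mp huv
  obtain ⟨c, hc, rfl⟩ := (isPrefix_iff cs).mp hvw
  rw [mul_assoc]
  exact ((lengthAdd_assoc cs).mp ⟨hb, hc⟩).2.isPrefix

theorem length_le_of_isPrefix (h : cs.derivedGerm.IsPrefix u v) :
    cs.length u ≤ cs.length v := by
  obtain ⟨b, hb, rfl⟩ := (isPrefix_iff cs).mp h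
  rw [hb]
  exact Nat.le_add_right _ _

variable {cs} in
theorem LengthAdd.isPrefix_iff_mul (h : LengthAdd cs a c) : cs.derivedGerm.IsPrefix b c ↔
    LengthAdd cs a b ∧ cs.derivedGerm.IsPrefix (a * b) (a * c) := by
  constructor
  · intro hbc
    obtain ⟨d, hbd, rfl⟩ := (isPrefix_iff cs).mp hbc
    obtain ⟨hab, habd⟩ := (lengthAdd_assoc cs).mpr ⟨hbd, h⟩
    exact ⟨hab, mul_assoc a b d ▸ habd.isPrefix⟩
  · rintro ⟨hab, hp⟩
    obtain ⟨d, hd, heq⟩ := (isPrefix_iff cs).mp hp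
    rw [mul_assoc, mul_right_inj] at heq
    exact heq ▸ ((lengthAdd_assoc cs).mp ⟨hab, hd⟩).1.isPrefix

theorem simple_isPrefix_iff : cs.derivedGerm.IsPrefix (cs.simple i) w ↔ cs.IsLeftDescent w i := by
  constructor
  · intro h
    obtain ⟨b, hb, rfl⟩ := (isPrefix_iff cs).mp h
    rw [LengthAdd, length_simple] at hb
    rw [IsLeftDescent, simple_mul_simple_cancel_left, hb]
    lia
  · intro h
    refine (isPrefix_iff cs).mpr ⟨cs.simple i * w, ?_, simple_mul_simple_cancel_left cs i⟩
    rw [LengthAdd, simple_mul_simple_cancel_left, length_simple, add_comm]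
    exact ((cs.isLeftDescent_iff).mp h).symm

end Prefixes

section GreatestPrefix

open Relation

variable {v w x y a b : W}

/-- The covering relation of the right weak order on the set of prefixes `h` of `v` for which
`w * h` is a reduced product. -/
def PrefixCovBy (w v x y : W) : Prop :=
  (∃ i, LengthAdd cs x (cs.simple i) ∧ x * cs.simple i = y) ∧
    LengthAdd cs w y ∧ cs.derivedGerm.IsPrefix y v

theorem wellFounded_flip_prefixCovBy (w v : W) : WellFounded (flip (PrefixCovBy cs w v)) := by
  refine Subrelation.wf ?_ (measure fun x => cs.length v - cs.length x).wf
  rintro _ x ⟨⟨i, hi, rfl⟩, -, hv⟩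
  have hle := length_le_of_isPrefix cs hv
  rw [LengthAdd, length_simple] at hi
  change cs.length v - cs.length (x * cs.simple i) < cs.length v - cs.length x
  lia

variable {cs}

theorem reflTransGen_prefixCovBy (hxy : cs.derivedGerm.IsPrefix x y) (hwy : LengthAdd cs w y)
    (hyv : cs.derivedGerm.IsPrefix y v) : ReflTransGen (PrefixCovBy cs w v) x y := by
  obtain ⟨b, hb, rfl⟩ := (isPrefix_iff cs).mp hxy
  clear hxy
  obtain ⟨ω, hω, rfl⟩ := cs.exists_isReduced b
  induction ω using List.reverseRecOn with
  | nil => rw [wordProd_nil, mul_one]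
  | append_singleton ω i ih =>
    obtain ⟨hω, -, hωi⟩ := (isReduced_append_iff cs).mp hω
    rw [wordProd_append, wordProd_singleton] at *
    obtain ⟨hxω, hxωi⟩ := (lengthAdd_assoc cs).mpr ⟨hωi, hb⟩
    rw [← mul_assoc] at *
    have hlast := hxωi.isPrefix
    exact (ih hω hxω (hwy.isPrefix_iff_mul.mp hlast).1 (isPrefix_trans hlast hyv)).tail
      ⟨⟨i, hxωi, rfl⟩, hwy, hyv⟩

theorem isPrefix_of_reflTransGen (h : ReflTransGen (PrefixCovBy cs w v) x y) :
    cs.derivedGerm.IsPrefix x y := by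
  induction h with
  | refl => exact isPrefix_refl cs x
  | tail _ hstep ih =>
    obtain ⟨⟨i, hi, rfl⟩, -⟩ := hstep
    exact isPrefix_trans ih hi.isPrefix

theorem lengthAdd_and_isPrefix_of_reflTransGen (h : ReflTransGen (PrefixCovBy cs w v) x y)
    (hwx : LengthAdd cs w x) (hxv : cs.derivedGerm.IsPrefix x v) :
    LengthAdd cs w y ∧ cs.derivedGerm.IsPrefix y v := by
  rcases h.cases_tail with rfl | ⟨z, -, hstep⟩
  · exact ⟨hwx, hxv⟩
  · exact hstep.2

/-- The common upper bound is obtained by multiplying `x` by the component of `x⁻¹ * v` in the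
parabolic subgroup of rank two. -/
theorem prefixCovBy_locallyConfluent (hxa : PrefixCovBy cs w v x a) (hxb : PrefixCovBy cs w v x b) :
    ∃ d, ReflTransGen (PrefixCovBy cs w v) a d ∧ ReflTransGen (PrefixCovBy cs w v) b d := by
  obtain ⟨⟨i, hxi, rfl⟩, hwi, hiv⟩ := hxa
  obtain ⟨⟨j, hxj, rfl⟩, hwj, hjv⟩ := hxb
  obtain ⟨t, hxt, rfl⟩ := (isPrefix_iff cs).mp (isPrefix_trans hxi.isPrefix hiv)
  obtain ⟨p, hp, q, hq, rfl⟩ := exists_mem_standardParabolic_mul_eq cs {i, j} t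
  obtain ⟨hwx, hwxi⟩ := (lengthAdd_assoc cs).mpr ⟨hxi, hwi⟩
  obtain ⟨-, hwxj⟩ := (lengthAdd_assoc cs).mpr ⟨hxj, hwj⟩
  obtain ⟨hxp, hpv⟩ := hxt.isPrefix_iff_mul.mp (hq p hp).isPrefix
  have hwxp : LengthAdd cs (w * x) p := by
    apply lengthAdd_of_forall_not_isRightDescent cs _ hp
    rintro k (rfl | rfl)
    · exact (lengthAdd_simple_iff cs).mp hwxi
    · exact (lengthAdd_simple_iff cs).mp hwxj
  have reaches {k : B} (hk : k ∈ ({i, j} : Set B)) (hxk : LengthAdd cs x (cs.simple k))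
      (hkv : cs.derivedGerm.IsPrefix (x * cs.simple k) (x * (p * q))) :
      ReflTransGen (PrefixCovBy cs w (x * (p * q))) (x * cs.simple k) (x * p) := by
    have hdesc := (simple_isPrefix_iff cs).mp (hxt.isPrefix_iff_mul.mpr ⟨hxk, hkv⟩)
    rw [isLeftDescent_mul_iff cs hp hq hk, ← simple_isPrefix_iff] at hdesc
    exact reflTransGen_prefixCovBy (hxp.isPrefix_iff_mul.mp hdesc).2
      ((lengthAdd_assoc cs).mp ⟨hwx, hwxp⟩).2 hpv
  exact ⟨x * p, reaches (by simp) hxi hiv, reaches (by simp) hxj hjv⟩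

variable (cs)

theorem exists_greatest_isPrefix (w v : W) :
    ∃ g, LengthAdd cs w g ∧ cs.derivedGerm.IsPrefix g v ∧
      ∀ h, LengthAdd cs w h → cs.derivedGerm.IsPrefix h v → cs.derivedGerm.IsPrefix h g := by
  obtain ⟨g, hg, hmax⟩ := exists_forall_reflTransGen_of_locallyConfluent
    (wellFounded_flip_prefixCovBy cs w v) (fun _ _ _ => prefixCovBy_locallyConfluent) 1
  obtain ⟨hwg, hgv⟩ :=
    lengthAdd_and_isPrefix_of_reflTransGen hg (lengthAdd_one cs w) (one_isPrefix cs v)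
  exact ⟨g, hwg, hgv, fun h hwh hhv =>
    isPrefix_of_reflTransGen (hmax h (reflTransGen_prefixCovBy (one_isPrefix cs h) hwh hhv))⟩

theorem hasGreedySplits_derivedGerm : cs.derivedGerm.HasGreedySplits where
  exists_mul_eq f g h fg k hfg hk := by
    obtain ⟨hadd, rfl⟩ := (mul_eq_some_iff cs).mp hfg
    have hgh := ((lengthAdd_assoc cs).mp ⟨hadd, ((mul_eq_some_iff cs).mp hk).1⟩).1
    exact ⟨g * h, (mul_eq_some_iff cs).mpr ⟨hgh, rfl⟩⟩
  mul_left_cancel f g h k hg hh := by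
    simp only [mul_eq_some_iff] at hg hh
    exact mul_left_cancel (hg.2.trans hh.2.symm)
  eq_one_of_mul_eq_one f g h := by
    obtain ⟨hadd, hfg⟩ := (mul_eq_some_iff cs).mp h
    rw [LengthAdd, hfg, show cs.derivedGerm.one = 1 from rfl, length_one] at hadd
    exact cs.length_eq_zero_iff.mp (by lia)
  exists_isGreedySplit f v := by
    obtain ⟨a, hfa, hav, hmax⟩ := exists_greatest_isPrefix cs f v
    obtain ⟨b, hab⟩ := hav
    exact ⟨a, b, f * a, (mul_eq_some_iff cs).mpr ⟨hfa, rfl⟩, hab,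
      fun h k hhv hfh => hmax h ((mul_eq_some_iff cs).mp hfh).1 hhv⟩

end GreatestPrefix

/-! ### Matsumoto's theorem -/

section Matsumoto

variable {N : Type*} [Monoid N]

variable (M) in
/-- The family `f` satisfies the Artin–Tits relations of the Coxeter matrix `M`. -/
def SatisfiesBraidRelations (f : B → N) : Prop :=
  ∀ i j, i ≠ j → M i j ≠ 0 → ((braidWord M i j).map f).prod = ((braidWord M j i).map f).prod

theorem exists_concat_eq_braidWord {i j : B} (hM : M i j ≠ 0) :
    ∃ ω : List B, ω.concat j = braidWord M i j := by
  obtain ⟨m, hm⟩ := Nat.exists_eq_succ_of_ne_zero hM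
  exact ⟨alternatingWord j i m, by rw [braidWord, hm, alternatingWord_succ]⟩

theorem isReduced_append_braidWord {i j : B} {δ : List B} (hδ : cs.IsReduced δ)
    (hadd : LengthAdd cs (cs.wordProd δ) (cs.wordProd (braidWord M i j))) :
    cs.IsReduced (δ ++ braidWord M i j) :=
  (isReduced_append_iff cs).mpr
    ⟨hδ, isReduced_alternatingWord cs i j (Or.inr le_rfl), hadd⟩

/-- If reduced words of the same element end in different letters `i` and `j`,
then both can be compared with reduced words that end in the two sides of the braid relation. -/
theorem prod_map_eq_of_isReduced {f : B → N} (hf : SatisfiesBraidRelations M f) {ω ω' : List B}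
    (hω : cs.IsReduced ω) (hω' : cs.IsReduced ω') (h : cs.wordProd ω = cs.wordProd ω') :
    (ω.map f).prod = (ω'.map f).prod := by
  induction hn : ω.length generalizing ω ω' with
  | zero =>
    have hn' : ω'.length = 0 := by rw [← hω'.eq, ← h, hω.eq, hn]
    rw [List.length_eq_zero_iff.mp hn, List.length_eq_zero_iff.mp hn']
  | succ n ih =>
    have hn' : ω'.length = n + 1 := by rw [← hω'.eq, ← h, hω.eq, hn]
    have ih_concat {α β γ : List B} {k : B} (hα : cs.IsReduced (α.concat k))
        (hγ : cs.IsReduced γ) (hβ : β.concat k = γ)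
        (hαγ : cs.wordProd (α.concat k) = cs.wordProd γ) (hl : (α.concat k).length = n + 1) :
        ((α.concat k).map f).prod = (γ.map f).prod := by
      subst hβ
      rw [wordProd_concat, wordProd_concat, mul_left_inj] at hαγ
      rw [List.length_concat, Nat.add_right_cancel_iff] at hl
      simp only [List.concat_eq_append, List.map_append, List.prod_append,
        ih ((isReduced_concat_iff cs).mp hα).1 ((isReduced_concat_iff cs).mp hγ).1 hαγ hl]
    obtain ⟨α, i, rfl⟩ := ω.eq_nil_or_concat.resolve_left (List.ne_nil_of_length_eq_add_one hn)
    obtain ⟨β, j, rfl⟩ := ω'.eq_nil_or_concat.resolve_left (List.ne_nil_of_length_eq_add_one hn')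
    rcases eq_or_ne i j with rfl | hij
    · exact ih_concat hω hω' rfl h hn
    obtain ⟨hM, b, hb, hbu⟩ := exists_lengthAdd_wordProd_braidWord cs
      (isRightDescent_wordProd_concat cs hω) (h ▸ isRightDescent_wordProd_concat cs hω')
    have hM' : M j i ≠ 0 := M.symmetric i j ▸ hM
    have hbraid := cs.wordProd_braidWord_eq i j
    obtain ⟨δ, hδ, rfl⟩ := cs.exists_isReduced b
    obtain ⟨τ, hτ⟩ := exists_concat_eq_braidWord hM
    obtain ⟨τ', hτ'⟩ := exists_concat_eq_braidWord hM'
    have hδτ := isReduced_append_braidWord cs hδ hb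
    have hδτ' := isReduced_append_braidWord cs hδ (hbraid ▸ hb)
    calc ((α.concat i).map f).prod = ((δ ++ braidWord M j i).map f).prod :=
          ih_concat (β := δ ++ τ') hω hδτ' (by simp [← hτ'])
            (by rw [wordProd_append, ← hbraid, hbu]) hn
      _ = ((δ ++ braidWord M i j).map f).prod := by
          simp only [List.map_append, List.prod_append, hf i j hij hM]
      _ = ((β.concat j).map f).prod :=
          (ih_concat (β := δ ++ τ) hω' hδτ (by simp [← hτ])
            (by rw [wordProd_append, hbu, h]) hn').symm

end Matsumoto

section ArtinMonoid

variable {N : Type*} [Monoid N]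

variable (f : B → N) in
/-- The product of the values of `f` on the letters of a chosen reduced word of `w`. -/
noncomputable def reducedProd (w : W) : N :=
  ((cs.exists_isReduced w).choose.map f).prod

section BraidRelations

variable {f : B → N} (hf : SatisfiesBraidRelations M f)

include hf

theorem reducedProd_wordProd {ω : List B} (hω : cs.IsReduced ω) :
    reducedProd cs f (cs.wordProd ω) = (ω.map f).prod :=
  have hspec := (cs.exists_isReduced (cs.wordProd ω)).choose_spec
  prod_map_eq_of_isReduced cs hf hspec.1 hω hspec.2.symm

theorem reducedProd_one : reducedProd cs f 1 = 1 := by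
  simpa using reducedProd_wordProd cs hf (ω := []) (by simp [CoxeterSystem.IsReduced])

theorem reducedProd_mul {a b : W} (h : LengthAdd cs a b) :
    reducedProd cs f (a * b) = reducedProd cs f a * reducedProd cs f b := by
  obtain ⟨ω, hω, rfl⟩ := cs.exists_isReduced a
  obtain ⟨τ, hτ, rfl⟩ := cs.exists_isReduced b
  rw [← wordProd_append, reducedProd_wordProd cs hf ((isReduced_append_iff cs).mpr ⟨hω, hτ, h⟩),
    reducedProd_wordProd cs hf hω, reducedProd_wordProd cs hf hτ, List.map_append, List.prod_append]

end BraidRelations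

theorem toMon_wordProd {ω : List B} (hω : cs.IsReduced ω) :
    cs.derivedGerm.toMon (cs.wordProd ω) =
      (ω.map fun i => cs.derivedGerm.toMon (cs.simple i)).prod := by
  induction ω with
  | nil =>
    rw [wordProd_nil, List.map_nil, List.prod_nil]
    exact cs.derivedGerm.toMon_one
  | cons i ω ih =>
    obtain ⟨hω, hi⟩ := (isReduced_cons_iff cs).mp hω
    rw [← simple_lengthAdd_iff] at hi
    rw [List.map_cons, List.prod_cons, ← ih hω,
      Germ.toMon_mul_toMon ((mul_eq_some_iff cs).mpr ⟨hi, rfl⟩), wordProd_cons]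

theorem satisfiesBraidRelations_of :
    SatisfiesBraidRelations M (PresentedMonoid.of M.ArtinRel) := by
  intro i j hij hM
  have mk_ofList (ω : List B) : PresentedMonoid.mk M.ArtinRel (FreeMonoid.ofList ω) =
      (ω.map (PresentedMonoid.of M.ArtinRel)).prod := by
    induction ω with
    | nil => rfl
    | cons i ω ih => rw [FreeMonoid.ofList_cons, map_mul, ih, List.map_cons, List.prod_cons]; rfl
  rw [← mk_ofList, ← mk_ofList]
  exact PresentedMonoid.mk_eq_mk_of_rel (.braid i j hij hM)

/-- The homomorphism that maps the class of `w` to the class of the reduced words of `w`. -/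
noncomputable def monToArtin : cs.derivedGerm.Mon →* M.ArtinMonoid :=
  cs.derivedGerm.lift (reducedProd cs (PresentedMonoid.of M.ArtinRel))
    (reducedProd_one cs satisfiesBraidRelations_of) (by
      intro a b c h
      obtain ⟨hab, rfl⟩ := (mul_eq_some_iff cs).mp h
      exact (reducedProd_mul cs satisfiesBraidRelations_of hab).symm)

theorem monToArtin_toMon_wordProd {ω : List B} (hω : cs.IsReduced ω) :
    monToArtin cs (cs.derivedGerm.toMon (cs.wordProd ω)) =
      (ω.map (PresentedMonoid.of M.ArtinRel)).prod :=
  reducedProd_wordProd cs satisfiesBraidRelations_of hω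

theorem monToArtin_toMon_simple (i : B) :
    monToArtin cs (cs.derivedGerm.toMon (cs.simple i)) = PresentedMonoid.of M.ArtinRel i := by
  simpa using monToArtin_toMon_wordProd cs (isReduced_singleton cs i)

/-- The homomorphism that maps the generators to the classes of the simple reflections. -/
noncomputable def artinToMon : M.ArtinMonoid →* cs.derivedGerm.Mon :=
  PresentedMonoid.lift (fun i => cs.derivedGerm.toMon (cs.simple i)) (by
    rintro _ _ ⟨i, j, -, -⟩
    rw [FreeMonoid.lift_apply, FreeMonoid.lift_apply, FreeMonoid.toList_ofList,
      FreeMonoid.toList_ofList, braidWord, braidWord,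
      ← toMon_wordProd cs (isReduced_alternatingWord cs i j (.inr le_rfl)),
      ← toMon_wordProd cs (isReduced_alternatingWord cs j i (.inr le_rfl))]
    exact congrArg _ (cs.wordProd_braidWord_eq i j))

theorem artinToMon_of (i : B) :
    artinToMon cs (PresentedMonoid.of M.ArtinRel i) = cs.derivedGerm.toMon (cs.simple i) :=
  rfl

/-- The identification of the monoid of the derived germ with the Artin–Tits monoid. -/
noncomputable def monEquivArtin : cs.derivedGerm.Mon ≃* M.ArtinMonoid :=
  MonoidHom.toMulEquiv (monToArtin cs) (artinToMon cs)
    (PresentedMonoid.ext _ fun w => by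
      obtain ⟨ω, hω, rfl⟩ := cs.exists_isReduced w
      change artinToMon cs (monToArtin cs (cs.derivedGerm.toMon _)) = cs.derivedGerm.toMon _
      rw [monToArtin_toMon_wordProd cs hω, map_list_prod, List.map_map, toMon_wordProd cs hω]
      exact congrArg _ (List.map_congr_left fun i _ => artinToMon_of cs i))
    (PresentedMonoid.ext _ fun i =>
      (congrArg _ (artinToMon_of cs i)).trans (monToArtin_toMon_simple cs i))

end ArtinMonoid

end CoxeterGerm

theorem mainTheorem12 {B W : Type*} [Group W] {M : CoxeterMatrix B} (cs : CoxeterSystem M W) :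
    cs.derivedGerm.IsGarside ∧
    ∃ e : cs.derivedGerm.Mon ≃* M.ArtinMonoid,
      ∀ i : B, e (PresentedMonoid.of cs.derivedGerm.Rel (cs.simple i)) =
        PresentedMonoid.of M.ArtinRel i :=
  ⟨(CoxeterGerm.hasGreedySplits_derivedGerm cs).isGarside, CoxeterGerm.monEquivArtin cs,
    CoxeterGerm.monToArtin_toMon_simple cs⟩
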